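/- **Setting.** Consider the following zero-sum game between an attacker and a defender, played over $N=336$ hourly stages. A state is $\langle b,n,x,y\rangle$: the backlog $b\in\mathbb Z$ of alerts, the number $n$ of remaining stages, the remaining budget $x$ of extra inspections of the defender, and the remaining budget $y$ of extra alerts of the attacker. Play starts at $\langle 0,N,X,Y\rangle$ with $X,Y\in\mathbb N$ and $X\le 28800$ (the operational value is $X=28800$). At each stage the attacker chooses $a$ and the defender chooses $d$ simultaneously, both from the action set of multiples of $60$ between $0$ and $2400$; then $A$ regular alerts arrive, where $A$ is Poisson with mean $1919$ and independent of the past and of the two choices, and $\mu=\mu_0=1920$ alerts are served (fixed service rate). The next state is $$b'=b-\min(d,x)+\min(a,y)+A-\mu,\quad n'=n-1,\quad x'=\max(0,x-d),\quad y'=\max(0,y-a).$$ The cost of the stage is $f(b-\min(d,x))$, the cost of the backlog after the extra inspections, where $f(z)=0$ for $z\le 1175$, $f(z)=\frac{z-1175}{4350-1175}$ for $1175<z<4350$, and $f(z)=1$ for $z\ge 4350$. The defender's long-term reward is the expectation of minus the maximum of the stage costs over all $N$ stages. Both players use behavioral strategies: the attacker observes all states and all actions; the defender observes $b,n,x$ and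 his own actions. The defender *guarantees* a reward $v$ with a strategy if his long-term reward is at least $v$ against every strategy of the attacker. **Theorem.** (a) If $Y-X>4800$, then every reward $v$ that the defender can guarantee satisfies $v\le -0.95$. This remains true if the defender may choose arbitrary $d\in\mathbb N$ at each stage. (b) If $Y\le X$, then for every integer $B\ge 1$ the defender can guarantee a reward of at least $$(1-f(B))\Bigl(1-\frac1B\Bigr)^{N\mu/B}-1 .$$ Further, when the extra inspections per hour are limited only by the remaining budget, this guarantee is provided by the simple rule $S1$: whenever the backlog exceeds $B$ by $x$, allocate $x$ extra inspections. It is also provided if $S1$ rounds its allocations up to multiples of any fixed integer $m\ge 1$ (for instance $m=60$). -/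

import Mathlib

namespace CSOC

/-- Length of the game: `336` hourly stages. -/
def horizon : ℕ := 336

/-- Nominal arrival rate of alerts per hour. -/
def arrivalRate : NNReal := 1919

/-- Fixed number of alerts served per hour by the regular analysts. -/
def serviceRate : ℕ := 1920

/-- Unit in which extra alerts and extra inspections are chosen. -/
def chunk : ℕ := 60

/-- Largest extra number of alerts (inspections) per hour. -/
def hourlyCap : ℕ := 2400

/-- The common action set of the two players: multiples of `chunk` between `0` and `hourlyCap`. -/
def actionSet : Set ℕ := {k | chunk ∣ k ∧ k ≤ hourlyCap}

/-- The normalised cost of a backlog `z`. -/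
noncomputable def f (z : ℝ) : ℝ :=
  if z ≤ 1175 then 0 else if z < 4350 then (z - 1175) / (4350 - 1175) else 1

/-- A state of the game: backlog `b`, number `n` of remaining stages, remaining extra inspections
`x` of the defender, remaining extra alerts `y` of the attacker. -/
structure State where
  b : ℤ
  n : ℕ
  x : ℕ
  y : ℕ

/-- What the defender sees of a state: everything except the attacker's remaining budget. -/
structure View where
  b : ℤ
  n : ℕ
  x : ℕ

def State.view (s : State) : View := ⟨s.b, s.n, s.x⟩

/-- One stage of a play: the state, the defender's action `d` and the attacker's action `a`. -/
structure Stage where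
  s : State
  d : ℕ
  a : ℕ

/-- What the defender sees of a stage that has been played: his view and his own action. -/
def Stage.view (w : Stage) : View × ℕ := (w.s.view, w.d)

/-- Inspections that are really carried out when the defender asks for `d`. -/
def State.inspected (s : State) (d : ℕ) : ℕ := min d s.x

/-- Extra alerts that are really sent when the attacker asks for `a`. -/
def State.sent (s : State) (a : ℕ) : ℕ := min a s.y

/-- The next state when `A` regular alerts arrive; states with `n = 0` are sinks.
The subtractions in the last three coordinates are truncated at `0`. -/
def State.next (s : State) (d a A : ℕ) : State :=
  if s.n = 0 then s
  else ⟨s.b - s.inspected d + s.sent a + A - serviceRate, s.n - 1, s.x - d, s.y - a⟩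

/-- The cost of one stage: the cost of the backlog that is left after the extra inspections. -/
noncomputable def Stage.cost (w : Stage) : ℝ :=
  if 0 < w.s.n then f ((w.s.b - w.s.inspected w.d : ℤ) : ℝ) else 0

/-- A behavioural strategy of the attacker. He observes all states and all actions of both players.
The first argument is the list of past stages, latest first, the second one the current state. -/
structure AttackerStrategy where
  act : List Stage → State → PMF ℕ
  mem_actionSet : ∀ h s, (act h s).support ⊆ actionSet

/-- A behavioural allocation rule of the defender, based on his past views and actions (latest
first) and his current view. The amounts are not restricted here; see `Admissible`. -/
abbrev DefenderRule := List (View × ℕ) → View → PMF ℕ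

/-- A defender strategy of the game: all amounts lie in the action set. -/
def DefenderRule.Admissible (τ : DefenderRule) : Prop :=
  ∀ h v, (τ h v).support ⊆ actionSet

/-- Number of regular alerts that arrive in one hour. -/
noncomputable def arrivals : PMF ℕ :=
  (ProbabilityTheory.poissonMeasure arrivalRate).toPMF

/-- The law of the first `t` stages of a play (latest first), together with the state reached.
Play starts with an empty backlog; both players act simultaneously and independently. -/
noncomputable def play (σ : AttackerStrategy) (τ : DefenderRule) (X Y : ℕ) :
    ℕ → PMF (List Stage × State)
  | 0 => PMF.pure ([], ⟨0, horizon, X, Y⟩)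
  | t + 1 =>
    (play σ τ X Y t).bind fun p =>
      (σ.act p.1 p.2).bind fun a =>
        (τ (p.1.map Stage.view) p.2.view).bind fun d =>
          arrivals.map fun A => (⟨p.2, d, a⟩ :: p.1, p.2.next d a A)

/-- The largest stage cost in a list of stages. All stage costs are nonnegative, and they vanish
in sink states, so over the `horizon` stages this is the supremum over the infinite play. -/
noncomputable def supCost (h : List Stage) : ℝ :=
  (h.map Stage.cost).foldr max 0

/-- The expected long-term reward of the defender: minus the expected supremum over time of the
stage costs. -/
noncomputable def expectedReward (σ : AttackerStrategy) (τ : DefenderRule) (X Y : ℕ) : ℝ :=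
  -∑' p : List Stage × State, (play σ τ X Y horizon p).toReal * supCost p.1

/-- With the rule `τ` the defender is guaranteed the expected long-term reward `v`, whatever the
attacker does. -/
def Guarantees (τ : DefenderRule) (X Y : ℕ) (v : ℝ) : Prop :=
  ∀ σ : AttackerStrategy, v ≤ expectedReward σ τ X Y

/-- The rule `S1` with threshold `B`, for allocations in units of `m`: if the backlog exceeds `B`
by `x`, allocate `x`, rounded up to a multiple of `m` (nothing is rounded for `m = 1`);
otherwise allocate nothing. -/
noncomputable def ruleS1 (m B : ℕ) : DefenderRule :=
  fun _ v => PMF.pure (((v.b - B).toNat + m - 1) / m * m)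

/-- The guaranteed reward `(1 - f(B)) (1 - 1/B) ^ (N μ / B) - 1`. -/
noncomputable def guarantee (B : ℕ) : ℝ :=
  (1 - f B) * (1 - 1 / (B : ℝ)) ^ ((horizon : ℝ) * serviceRate / B) - 1

end CSOC

/-! Let `noise` be the backlog corrected for what both sides have spent and for the drift. Whatever
the players do, it is a martingale with increments `A - 1919` of variance 1919, so everything
reduces to second moments.

(a) Under maximal attack, after 14 stages the attacker has spent his whole budget or at least 33600
≥ `X + 4800`. Even if the defender inspects all he has left, the backlog is at least `noise + 4786`,
far above 4350, and a Chebyshev-type bound finishes (`one_sub_f_le`, `expect_noise_sq_le`).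

(b) Under either rule, a backlog above `B` after inspections forces `noise ≥ B`. A maximal form of
Cantelli's inequality bounds the probability of this by `c / (B + c)` with `c = Nμ / B`; its
complement `B / (B + c)` is at least `(1 - 1/B) ^ c`. The maximal inequality is run as a
supermartingale, `costPotential`, frozen at 1 once a cost exceeds `f B` (`guarantees_of_le_noise`).
-/

namespace CSOC

open scoped ENNReal

/-! ### Expectations in `ℝ≥0∞`, free of integrability conditions -/

section Expectation

variable {α β : Type*}

/-- Expectation of a nonnegative function with respect to a probability mass function. -/
noncomputable def expect (p : PMF α) (g : α → ℝ≥0∞) : ℝ≥0∞ := ∑' a, p a * g a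

theorem expect_mono {p : PMF α} {g g' : α → ℝ≥0∞} (h : ∀ a ∈ p.support, g a ≤ g' a) :
    expect p g ≤ expect p g' := by
  refine ENNReal.tsum_le_tsum fun a => ?_
  by_cases ha : p a = 0
  · simp [ha]
  · exact mul_le_mul_right (h a ha) _

theorem expect_const (p : PMF α) (c : ℝ≥0∞) : expect p (fun _ => c) = c := by
  rw [expect, ENNReal.tsum_mul_right, p.tsum_coe, one_mul]

theorem expect_le_of_forall_le {p : PMF α} {g : α → ℝ≥0∞} {c : ℝ≥0∞}
    (h : ∀ a ∈ p.support, g a ≤ c) : expect p g ≤ c :=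
  (expect_mono h).trans_eq (expect_const p c)

theorem expect_add (p : PMF α) (g g' : α → ℝ≥0∞) :
    expect p (fun a => g a + g' a) = expect p g + expect p g' := by
  simp only [expect, mul_add, ENNReal.tsum_add]

theorem expect_pure (a : α) (g : α → ℝ≥0∞) : expect (PMF.pure a) g = g a := by
  classical
  rw [expect, tsum_eq_single a]
  · simp
  · intro b hb
    simp [hb]

theorem expect_bind (p : PMF α) (q : α → PMF β) (g : β → ℝ≥0∞) :
    expect (p.bind q) g = expect p fun a => expect (q a) g := by
  simp only [expect, PMF.bind_apply, ← ENNReal.tsum_mul_right, ← ENNReal.tsum_mul_left]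
  rw [ENNReal.tsum_comm]
  simp only [mul_assoc]

theorem expect_map (p : PMF α) (φ : α → β) (g : β → ℝ≥0∞) :
    expect (p.map φ) g = expect p fun a => g (φ a) := by
  simp only [PMF.map, expect_bind, Function.comp_apply, expect_pure]

theorem toReal_expect_ofReal (p : PMF α) {g : α → ℝ} (hg : ∀ a, 0 ≤ g a) :
    (expect p fun a => ENNReal.ofReal (g a)).toReal = ∑' a, (p a).toReal * g a := by
  rw [expect, ENNReal.tsum_toReal_eq fun a => ENNReal.mul_ne_top (p.apply_ne_top a)
    ENNReal.ofReal_ne_top]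
  simp only [ENNReal.toReal_mul, ENNReal.toReal_ofReal (hg _)]

end Expectation

/-! ### Second moments of the Poisson law -/

section Poisson

open Real
open scoped Nat

theorem hasSum_poisson_mul_id (r : NNReal) :
    HasSum (fun n : ℕ => exp (-r) * r ^ n / (n)! * n) r := by
  rw [← hasSum_nat_add_iff' 1]
  convert! (ProbabilityTheory.hasSum_one_poissonMeasure r).mul_left (r : ℝ) using 1
  · funext n
    rw [Nat.factorial_succ]
    push_cast
    field_simp
    exact pow_succ' _ _
  · simp

theorem hasSum_poisson_mul_descFactorial_two (r : NNReal) :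
    HasSum (fun n : ℕ => exp (-r) * r ^ n / (n)! * (n * (n - 1))) ((r : ℝ) ^ 2) := by
  rw [← hasSum_nat_add_iff' 1]
  convert! (hasSum_poisson_mul_id r).mul_left (r : ℝ) using 1
  · funext n
    rw [Nat.factorial_succ]
    push_cast
    field_simp
    ring
  · simp [sq]

theorem hasSum_poisson_mul_sq (r : NNReal) (α β z : ℝ) :
    HasSum (fun n : ℕ => exp (-r) * r ^ n / (n)! * (α + β * (z + n - r) ^ 2))
      (α + β * (z ^ 2 + r)) := by
  -- Expand the square in the basis `n(n-1)`, `n`, `1`, whose means are `r²`, `r`, `1`.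
  convert! (((hasSum_poisson_mul_descFactorial_two r).mul_left β).add
    ((hasSum_poisson_mul_id r).mul_left (β * (1 + 2 * (z - r))))).add
    ((ProbabilityTheory.hasSum_one_poissonMeasure r).mul_left (α + β * (z - r) ^ 2)) using 1
  · funext n
    ring
  · ring

theorem expect_arrivals_sq {α β : ℝ} (hα : 0 ≤ α) (hβ : 0 ≤ β) (z : ℝ) :
    expect arrivals (fun A => ENNReal.ofReal (α + β * (z + A - 1919) ^ 2)) =
      ENNReal.ofReal (α + β * (z ^ 2 + 1919)) := by
  have h := hasSum_poisson_mul_sq arrivalRate α β z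
  have hr : (arrivalRate : ℝ) = 1919 := by simp [arrivalRate]
  simp only [expect, arrivals, MeasureTheory.Measure.toPMF_apply,
    ProbabilityTheory.poissonMeasure_singleton]
  rw [hr] at h ⊢
  rw [← h.tsum_eq, ENNReal.ofReal_tsum_of_nonneg (fun n => by positivity) h.summable]
  refine tsum_congr fun n => ?_
  rw [ENNReal.ofReal_mul (by positivity)]

end Poisson

/-! ### Bounds for the stage cost and its maximum -/

section Cost

theorem f_nonneg (z : ℝ) : 0 ≤ f z := by
  unfold f
  split_ifs with h1 h2
  · exact le_rfl
  · exact div_nonneg (by linarith) (by norm_num)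
  · exact zero_le_one

theorem f_le_one (z : ℝ) : f z ≤ 1 := by
  unfold f
  split_ifs with h1 h2
  · exact zero_le_one
  · rw [div_le_one (by norm_num)]
    linarith
  · exact le_rfl

theorem f_mono : Monotone f := by
  intro u v huv
  by_cases hu : u ≤ 1175
  · rw [f, if_pos hu]
    exact f_nonneg v
  by_cases hv : v < 4350
  · rw [f, f, if_neg hu, if_pos (by linarith), if_neg (by linarith), if_pos hv]
    gcongr
  · rw [f.eq_1 v, if_neg (by linarith), if_neg hv]
    exact f_le_one u

theorem one_sub_f_le {z w : ℝ} (h : z + 4786 ≤ w) : 1 - f w ≤ 1 / 5000000 * z ^ 2 := by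
  refine (sub_le_sub_left (f_mono h) 1).trans ?_
  unfold f
  split_ifs with h1 h2
  · nlinarith
  · rw [one_sub_div (by norm_num), div_le_iff₀ (by norm_num)]
    -- With 436 = 4786 - 4350 and 872 = 2 · 436, the square gives `z² ≥ 1744 (-436 - z)`, and 1744 /
    -- 5000000 > 1 / 3175.
    nlinarith [sq_nonneg (z + 872)]
  · rw [sub_self]
    positivity

theorem Stage.cost_le_one (w : Stage) : w.cost ≤ 1 := by
  unfold Stage.cost
  split_ifs
  exacts [f_le_one _, zero_le_one]

theorem supCost_nil : supCost [] = 0 := rfl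

theorem supCost_cons (w : Stage) (h : List Stage) :
    supCost (w :: h) = max w.cost (supCost h) := rfl

theorem supCost_nonneg (h : List Stage) : 0 ≤ supCost h := by
  induction h with
  | nil => exact supCost_nil.ge
  | cons w h ih => exact ih.trans (le_max_right _ _)

theorem supCost_le_one (h : List Stage) : supCost h ≤ 1 := by
  induction h with
  | nil => exact supCost_nil.trans_le zero_le_one
  | cons w h ih => exact max_le w.cost_le_one ih

end Cost

/-! ### One-step inequalities along a play, and the martingale -/

section Play

variable {σ : AttackerStrategy} {τ : DefenderRule} {X Y : ℕ}

/-- Supermartingale step: the hypothesis is uniform in both actions, so randomisation and hidden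
information play no role. -/
theorem expect_play_succ_le {t : ℕ} {V V' : List Stage × State → ℝ≥0∞}
    (h : ∀ p ∈ (play σ τ X Y t).support, ∀ a ∈ (σ.act p.1 p.2).support,
      ∀ d ∈ (τ (p.1.map Stage.view) p.2.view).support,
        expect arrivals (fun A => V' (⟨p.2, d, a⟩ :: p.1, p.2.next d a A)) ≤ V p) :
    expect (play σ τ X Y (t + 1)) V' ≤ expect (play σ τ X Y t) V := by
  simp only [play, expect_bind, expect_map]
  exact expect_mono fun p hp => expect_le_of_forall_le fun a ha =>
    expect_le_of_forall_le fun d hd => h p hp a ha d hd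

theorem play_invariant {I : ℕ → State → Prop} (h0 : I 0 ⟨0, horizon, X, Y⟩)
    (hstep : ∀ t h s, I t s → ∀ a ∈ (σ.act h s).support,
      ∀ d ∈ (τ (h.map Stage.view) s.view).support, ∀ A, I (t + 1) (s.next d a A)) (t : ℕ) :
    ∀ p ∈ (play σ τ X Y t).support, I t p.2 := by
  induction t with
  | zero =>
    intro p hp
    rw [play, PMF.mem_support_pure_iff] at hp
    rwa [hp]
  | succ t ih =>
    intro p hp
    simp only [play, PMF.mem_support_bind_iff, PMF.mem_support_map_iff] at hp
    obtain ⟨q, hq, a, ha, d, hd, A, -, rfl⟩ := hp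
    exact hstep t q.1 q.2 (ih q hq) a ha d hd A

theorem expectedReward_eq (σ : AttackerStrategy) (τ : DefenderRule) (X Y : ℕ) :
    expectedReward σ τ X Y =
      -(expect (play σ τ X Y horizon) fun p => ENNReal.ofReal (supCost p.1)).toReal := by
  rw [expectedReward, toReal_expect_ofReal (play σ τ X Y horizon) (g := fun p => supCost p.1)
    fun p => supCost_nonneg p.1]

theorem le_expectedReward {c : ℝ} (hc : 0 ≤ c)
    (h : expect (play σ τ X Y horizon) (fun p => ENNReal.ofReal (supCost p.1)) ≤
      ENNReal.ofReal c) : -c ≤ expectedReward σ τ X Y := by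
  rw [expectedReward_eq, neg_le_neg_iff]
  exact ENNReal.toReal_le_of_le_ofReal hc h

theorem expectedReward_le {c : ℝ} (hc : 0 ≤ c)
    (h : expect (play σ τ X Y horizon) (fun p => ENNReal.ofReal (1 - supCost p.1)) ≤
      ENNReal.ofReal c) : expectedReward σ τ X Y ≤ c - 1 := by
  rw [expectedReward_eq]
  set p := play σ τ X Y horizon
  have hsum : expect p (fun q => ENNReal.ofReal (supCost q.1)) +
      expect p (fun q => ENNReal.ofReal (1 - supCost q.1)) = 1 := by
    rw [← expect_add, ← expect_const p 1]
    congr 1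
    funext q
    rw [← ENNReal.ofReal_add (supCost_nonneg _) (sub_nonneg.2 (supCost_le_one _))]
    simp
  have hne := ENNReal.add_ne_top.1 (hsum.trans_ne ENNReal.one_ne_top)
  have hreal := congrArg ENNReal.toReal hsum
  rw [ENNReal.toReal_add hne.1 hne.2, ENNReal.toReal_one] at hreal
  have := ENNReal.toReal_le_of_le_ofReal hc h
  linarith

/-- The backlog that would be present if both players had spent the same amount, recentred so that
it moves by `A - 1919` at every stage, whatever the players do. -/
noncomputable def noise (X Y : ℕ) (s : State) : ℝ :=
  s.b - s.x + s.y + X - Y + horizon - s.n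

theorem noise_start (X Y : ℕ) : noise X Y ⟨0, horizon, X, Y⟩ = 0 := by
  simp only [noise]
  push_cast
  ring

theorem noise_next {s : State} (hs : 0 < s.n) (d a A : ℕ) :
    noise X Y (s.next d a A) = noise X Y s + A - 1919 := by
  have hd : ((s.x - d : ℕ) : ℝ) + (min d s.x : ℕ) = s.x := by norm_cast; omega
  have ha : ((s.y - a : ℕ) : ℝ) + (min a s.y : ℕ) = s.y := by norm_cast; omega
  have hn : ((s.n - 1 : ℕ) : ℝ) + 1 = s.n := by norm_cast; omega
  simp only [noise, State.next, if_neg hs.ne', State.inspected, State.sent, serviceRate]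
  push_cast at hd ha hn ⊢
  linarith

/-- Each stage adds variance 1919, or nothing in a sink; the induction collects it in `α`. -/
theorem expect_noise_sq_le {β : ℝ} (hβ : 0 ≤ β) (t : ℕ) {α : ℝ} (hα : 0 ≤ α) :
    expect (play σ τ X Y t) (fun p => ENNReal.ofReal (α + β * noise X Y p.2 ^ 2)) ≤
      ENNReal.ofReal (α + β * (1919 * t)) := by
  induction t generalizing α with
  | zero =>
    rw [play, expect_pure, noise_start]
    simp
  | succ t ih =>
    refine (expect_play_succ_le
      (V := fun p => ENNReal.ofReal ((α + β * 1919) + β * noise X Y p.2 ^ 2)) ?_).trans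
      ((ih (by positivity)).trans_eq ?_)
    · rintro ⟨h, s⟩ - a - d -
      rcases Nat.eq_zero_or_pos s.n with hs | hs
      · simp only [State.next, if_pos hs, expect_const]
        exact ENNReal.ofReal_le_ofReal (by linarith)
      · simp only [noise_next hs]
        rw [expect_arrivals_sq hα hβ]
        exact ENNReal.ofReal_le_ofReal (by linarith)
    · push_cast
      ring_nf

theorem expect_one_sub_supCost_antitone :
    Antitone fun t => expect (play σ τ X Y t) fun p => ENNReal.ofReal (1 - supCost p.1) := by
  refine antitone_nat_of_succ_le fun t => expect_play_succ_le fun p _ a _ d _ => ?_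
  simp only [expect_const, supCost_cons]
  exact ENNReal.ofReal_le_ofReal (sub_le_sub_left (le_max_right _ _) 1)

end Play

/-! ### Part (a): the maximal attack -/

section Attack

/-- The attacker who asks for the largest possible number of extra alerts at every stage. -/
noncomputable def maximalAttack : AttackerStrategy where
  act _ _ := PMF.pure hourlyCap
  mem_actionSet _ _ := by
    rw [PMF.support_pure, Set.singleton_subset_iff]
    exact ⟨by norm_num [chunk, hourlyCap], le_rfl⟩

theorem maximalAttack_invariant (τ : DefenderRule) (X Y t : ℕ) :
    ∀ p ∈ (play maximalAttack τ X Y t).support, t ≤ horizon →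
      p.2.n = horizon - t ∧ p.2.x ≤ X ∧ p.2.y = Y - hourlyCap * t := by
  refine play_invariant
    (I := fun t s => t ≤ horizon → s.n = horizon - t ∧ s.x ≤ X ∧ s.y = Y - hourlyCap * t)
    (by simp) ?_ t
  intro t h s hs a ha d _ A ht
  obtain ⟨hn, hx, hy⟩ := hs (by omega)
  obtain rfl : a = hourlyCap := (PMF.mem_support_pure_iff _ _).1 ha
  rw [State.next, if_neg (by omega)]
  refine ⟨?_, ?_, ?_⟩ <;> simp only <;> simp only [hourlyCap] at * <;> omega

theorem expectedReward_maximalAttack_le {X Y : ℕ} (hX : X ≤ 28800) (hXY : X + 4800 < Y)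
    (τ : DefenderRule) : expectedReward maximalAttack τ X Y ≤ -0.95 := by
  refine (expectedReward_le (c := 0.05) (by norm_num) ?_).trans (by norm_num)
  -- Only the fifteenth stage is used: 14 · 2400 = 28800 + 4800, and the drift up to then costs 14,
  -- whence 4786 = 4800 - 14.
  refine (expect_one_sub_supCost_antitone (by norm_num [horizon] : 14 + 1 ≤ horizon)).trans ?_
  refine (expect_play_succ_le
    (V := fun p => ENNReal.ofReal (0 + 1 / 5000000 * noise X Y p.2 ^ 2)) ?_).trans
    ((expect_noise_sq_le (by norm_num) 14 le_rfl).trans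
      (ENNReal.ofReal_le_ofReal (by norm_num)))
  rintro ⟨h, s⟩ hp a - d -
  obtain ⟨hn, hx, hy⟩ := maximalAttack_invariant τ X Y 14 _ hp (by norm_num [horizon])
  simp only [expect_const, supCost_cons]
  refine ENNReal.ofReal_le_ofReal ((sub_le_sub_left (le_max_left _ _) 1).trans ?_)
  simp only [horizon, hourlyCap] at hn hx hy
  rw [zero_add, Stage.cost, if_pos (by simp only [hn]; norm_num)]
  refine one_sub_f_le ?_
  have h1 : ((min d s.x : ℕ) : ℝ) ≤ s.x := by exact_mod_cast min_le_right d s.x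
  have h2 : (s.y : ℝ) + X + 4800 ≤ Y := by norm_cast; omega
  simp only [noise, State.inspected, horizon, hn]
  push_cast at h1 ⊢
  linarith

end Attack

/-! ### Part (b): a maximal Cantelli inequality and two defences -/

section Defence

theorem one_sub_one_div_rpow_le {B a : ℝ} (hB : 1 ≤ B) (ha : 0 ≤ a) :
    (1 - 1 / B) ^ a ≤ B / (B + a) := by
  have hB0 : 0 < B := by linarith
  calc (1 - 1 / B) ^ a ≤ Real.exp (-(1 / B)) ^ a := by
        refine Real.rpow_le_rpow ?_ (Real.one_sub_le_exp_neg _) ha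
        rw [sub_nonneg, div_le_one hB0]
        exact hB
    _ = (Real.exp (a / B))⁻¹ := by
        rw [← Real.exp_mul, ← Real.exp_neg]
        congr 1
        ring
    _ ≤ (a / B + 1)⁻¹ := inv_anti₀ (by positivity) (Real.add_one_le_exp _)
    _ = B / (B + a) := by
        field_simp
        ring

/-- Weight of the Cantelli bound for the noise to reach the level `B`. -/
noncomputable def cantelliShift (B : ℕ) : ℝ := horizon * serviceRate / B

/-- Upper bound for the expected final cost from state `s`, if no cost above `f B` has occurred. -/
noncomputable def costBound (X Y B : ℕ) (s : State) : ℝ :=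
  f B + (1 - f B) / (B + cantelliShift B) ^ 2 *
    ((noise X Y s + cantelliShift B) ^ 2 + serviceRate * s.n)

open scoped Classical in
/-- Upper bound for the expected final cost, given the past stages and the current state. -/
noncomputable def costPotential (X Y B : ℕ) (p : List Stage × State) : ℝ :=
  if supCost p.1 ≤ f B then costBound X Y B p.2 else 1

variable {X Y B : ℕ}

theorem cantelliShift_nonneg (B : ℕ) : 0 ≤ cantelliShift B := by
  unfold cantelliShift
  positivity

theorem costBound_coeff_nonneg (B : ℕ) : 0 ≤ (1 - f B) / (B + cantelliShift B) ^ 2 :=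
  div_nonneg (sub_nonneg.2 (f_le_one _)) (sq_nonneg _)

theorem f_le_costBound (X Y B : ℕ) (s : State) : f B ≤ costBound X Y B s :=
  le_add_of_nonneg_right (mul_nonneg (costBound_coeff_nonneg B) (by positivity))

theorem one_le_costBound (hB : 1 ≤ B) {s : State} (h : (B : ℝ) ≤ noise X Y s) :
    1 ≤ costBound X Y B s := by
  have hB' : (1 : ℝ) ≤ B := by exact_mod_cast hB
  have ha := cantelliShift_nonneg B
  have hpos : 0 < ((B : ℝ) + cantelliShift B) ^ 2 := by positivity
  have hle : ((B : ℝ) + cantelliShift B) ^ 2 ≤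
      (noise X Y s + cantelliShift B) ^ 2 + serviceRate * s.n :=
    (pow_le_pow_left₀ (by positivity) (by linarith) 2).trans
      (le_add_of_nonneg_right (by positivity))
  have := mul_le_mul_of_nonneg_left hle (costBound_coeff_nonneg B)
  rw [div_mul_cancel₀ _ hpos.ne'] at this
  unfold costBound
  linarith

theorem supCost_le_costPotential (p : List Stage × State) :
    supCost p.1 ≤ costPotential X Y B p := by
  unfold costPotential
  split_ifs with h
  · exact h.trans (f_le_costBound _ _ _ _)
  · exact supCost_le_one _

/-- The shift `c = Nμ / B` minimises `(c² + Nμ) / (B + c)²`, with minimum `c / (B + c)`. -/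
theorem guarantee_le_neg_costBound_start (hB : 1 ≤ B) :
    guarantee B ≤ -costBound X Y B ⟨0, horizon, X, Y⟩ := by
  have hB' : (1 : ℝ) ≤ B := by exact_mod_cast hB
  have ha := cantelliShift_nonneg B
  have hc : (serviceRate : ℝ) * horizon = cantelliShift B * B := by
    unfold cantelliShift
    field_simp
  have hrpow := mul_le_mul_of_nonneg_left (one_sub_one_div_rpow_le hB' ha)
    (sub_nonneg.2 (f_le_one B))
  have hstart : costBound X Y B ⟨0, horizon, X, Y⟩ =
      1 - (1 - f B) * (B / (B + cantelliShift B)) := by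
    rw [costBound, noise_start, hc]
    field_simp
    ring
  rw [hstart, guarantee]
  change (1 - f B) * (1 - 1 / (B : ℝ)) ^ cantelliShift B - 1 ≤ _
  linarith

/-- The square gains 1919 in expectation while the term `serviceRate * s.n` loses 1920. -/
theorem expect_costBound_next_le (s : State) (d a : ℕ) :
    expect arrivals (fun A => ENNReal.ofReal (costBound X Y B (s.next d a A))) ≤
      ENNReal.ofReal (costBound X Y B s) := by
  rcases Nat.eq_zero_or_pos s.n with hs | hs
  · simp only [State.next, if_pos hs, expect_const, le_refl]
  have hβ := costBound_coeff_nonneg B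
  have hn : ((s.n - 1 : ℕ) : ℝ) + 1 = s.n := by norm_cast; omega
  have hnext (A : ℕ) : costBound X Y B (s.next d a A) =
      (f B + (1 - f B) / (B + cantelliShift B) ^ 2 * (serviceRate * (s.n - 1 : ℕ))) +
        (1 - f B) / (B + cantelliShift B) ^ 2 *
          (noise X Y s + cantelliShift B + A - 1919) ^ 2 := by
    rw [costBound, noise_next hs]
    simp only [State.next, if_neg hs.ne']
    ring
  simp only [hnext]
  rw [expect_arrivals_sq (add_nonneg (f_nonneg _) (by positivity)) hβ, costBound, ← hn]
  refine ENNReal.ofReal_le_ofReal ?_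
  simp only [serviceRate]
  push_cast
  nlinarith

/-- A rule under which the backlog after inspections exceeds `B` only when the noise does
guarantees the reward `guarantee B`. -/
theorem guarantees_of_le_noise {τ : DefenderRule} (hB : 1 ≤ B) {I : State → Prop}
    (h0 : I ⟨0, horizon, X, Y⟩)
    (hstep : ∀ h s d a A, d ∈ (τ h s.view).support → a ∈ actionSet → 0 < s.n → I s →
      I (s.next d a A))
    (hcost : ∀ h s d, d ∈ (τ h s.view).support → 0 < s.n → I s →
      (B : ℤ) < s.b - s.inspected d → (B : ℝ) ≤ noise X Y s) :
    Guarantees τ X Y (guarantee B) := by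
  intro σ
  have hinv (t : ℕ) : ∀ p ∈ (play σ τ X Y t).support, I p.2 := by
    refine play_invariant (I := fun _ => I) h0 ?_ t
    intro t h s hs a ha d hd A
    rcases Nat.eq_zero_or_pos s.n with hn | hn
    · rwa [State.next, if_pos hn]
    · exact hstep _ s d a A hd (σ.mem_actionSet h s ha) hn hs
  have hanti : Antitone fun t =>
      expect (play σ τ X Y t) fun p => ENNReal.ofReal (costPotential X Y B p) := by
    refine antitone_nat_of_succ_le fun t => expect_play_succ_le ?_
    rintro ⟨h, s⟩ hp a - d hd
    have hs : I s := hinv t _ hp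
    by_cases hh : supCost h ≤ f B
    · by_cases hw : (⟨s, d, a⟩ : Stage).cost ≤ f B
      · simp only [costPotential, supCost_cons, max_le_iff, hw, hh, and_self, if_true]
        exact expect_costBound_next_le s d a
      -- First cost above `f B`: the potential jumps to 1, but `noise ≥ B` had already made it at
      -- least 1.
      · simp only [costPotential, supCost_cons, hh, max_le_iff, hw, if_true, false_and, if_false,
          expect_const]
        refine ENNReal.ofReal_le_ofReal (one_le_costBound hB ?_)
        simp only [Stage.cost] at hw
        split_ifs at hw with hn
        · refine hcost _ s d hd hn hs (not_le.1 fun hle => hw (f_mono ?_))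
          exact_mod_cast hle
        · exact absurd (f_nonneg _) hw
    · simp only [costPotential, supCost_cons, max_le_iff, hh, and_false, if_false, expect_const,
        le_refl]
  refine (guarantee_le_neg_costBound_start (X := X) (Y := Y) hB).trans
    (le_expectedReward ((f_nonneg _).trans (f_le_costBound _ _ _ _)) ?_)
  refine (expect_mono fun p _ => ENNReal.ofReal_le_ofReal (supCost_le_costPotential p)).trans
    ((hanti (Nat.zero_le horizon)).trans_eq ?_)
  simp only [play, expect_pure, costPotential, supCost_nil, f_nonneg, if_true]

theorem guarantees_ruleS1 (hYX : Y ≤ X) (hB : 1 ≤ B) {m : ℕ} (hm : 1 ≤ m) :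
    Guarantees (ruleS1 m B) X Y (guarantee B) := by
  refine guarantees_of_le_noise hB (I := fun s => s.n ≤ horizon) le_rfl ?_ ?_
  · intro _ s d a A _ _ hn hs
    rw [State.next, if_neg hn.ne']
    exact (Nat.sub_le _ _).trans hs
  · intro _ s d hd _ hs hlt
    rw [ruleS1, PMF.mem_support_pure_iff] at hd
    have hle : (s.b - B).toNat ≤ d := by
      have := Nat.lt_div_mul_add (a := (s.b - B).toNat + m - 1) (b := m) (by omega)
      change d = ((s.b - B).toNat + m - 1) / m * m at hd
      omega
    -- The request covers the whole excess, so a backlog still above `B` means that the budget ran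
    -- out.
    have hpost : (B : ℤ) ≤ s.b - s.x := by
      simp only [State.inspected] at hlt
      omega
    have h1 : (B : ℝ) ≤ s.b - s.x := by exact_mod_cast hpost
    have h2 : (Y : ℝ) ≤ X := by exact_mod_cast hYX
    have h3 : (s.n : ℝ) ≤ horizon := by exact_mod_cast hs
    have h4 : (0 : ℝ) ≤ s.y := Nat.cast_nonneg _
    unfold noise
    linarith

/-- The rule that asks for the largest possible number of inspections at every stage. -/
noncomputable def maximalInspection : DefenderRule := fun _ _ => PMF.pure hourlyCap

theorem maximalInspection_admissible : maximalInspection.Admissible := by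
  intro _ _
  rw [maximalInspection, PMF.support_pure, Set.singleton_subset_iff]
  exact ⟨by norm_num [chunk, hourlyCap], le_rfl⟩

theorem guarantees_maximalInspection (hYX : Y ≤ X) (hB : 1 ≤ B) :
    Guarantees maximalInspection X Y (guarantee B) := by
  refine guarantees_of_le_noise hB (I := fun s => s.n ≤ horizon ∧
    s.x ≤ X - hourlyCap * (horizon - s.n) ∧ Y ≤ s.y + hourlyCap * (horizon - s.n))
    (by simp) ?_ ?_
  · intro _ s d a A hd ha hn hs
    obtain rfl : d = hourlyCap := (PMF.mem_support_pure_iff _ _).1 hd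
    have hcap := ha.2
    rw [State.next, if_neg hn.ne']
    simp only [hourlyCap] at *
    omega
  · intro _ s d hd _ hs hlt
    obtain rfl : d = hourlyCap := (PMF.mem_support_pure_iff _ _).1 hd
    -- Either the defender has spent 2400 at every past stage, hence no less than the attacker, or
    -- his budget is gone and `Y ≤ X` suffices.
    have hspent : s.x + Y ≤ s.y + X + min hourlyCap s.x := by
      simp only [hourlyCap] at *
      omega
    have h1 : (B : ℝ) ≤ s.b - (min hourlyCap s.x : ℕ) := by exact_mod_cast hlt.le
    have h2 : (s.x : ℝ) + Y ≤ s.y + X + (min hourlyCap s.x : ℕ) := by exact_mod_cast hspent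
    have h3 : (s.n : ℝ) ≤ horizon := by exact_mod_cast hs.1
    unfold noise
    linarith

end Defence

end CSOC

theorem theorem1 (X Y : ℕ) (hX : X ≤ 28800) :
    (X + 4800 < Y →
      ∀ (τ : CSOC.DefenderRule) (v : ℝ), CSOC.Guarantees τ X Y v → v ≤ -0.95) ∧
    (Y ≤ X → ∀ B : ℕ, 1 ≤ B →
      (∃ τ : CSOC.DefenderRule, τ.Admissible ∧ CSOC.Guarantees τ X Y (CSOC.guarantee B)) ∧
      ∀ m : ℕ, 1 ≤ m → CSOC.Guarantees (CSOC.ruleS1 m B) X Y (CSOC.guarantee B)) :=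
  ⟨fun hXY τ _ hv =>
    (hv CSOC.maximalAttack).trans (CSOC.expectedReward_maximalAttack_le hX hXY τ),
  fun hYX _ hB =>
    ⟨⟨CSOC.maximalInspection, CSOC.maximalInspection_admissible,
      CSOC.guarantees_maximalInspection hYX hB⟩,
    fun _ hm => CSOC.guarantees_ruleS1 hYX hB hm⟩⟩
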